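/- Let $\Gamma$ be an infinite group generated by a finite set $S$, and let $p>1$ be a real number. Let $G$ be the Cayley graph of $\Gamma$ with respect to $S$: its vertices are the elements of $\Gamma$, and two distinct elements $x_1,x_2$ are joined by an edge if and only if $x_1=x_2s^{\pm1}$ for some $s\in S$. Write $N_x$ for the set of neighbours of $x$ and, for $f:\Gamma\to\mathbb R$, put $$I_p(f)=\sum_{x\in\Gamma}\sum_{y\in N_x}|f(y)-f(x)|^p .$$ Let $D_p(\Gamma)$ be the space of all $f:\Gamma\to\mathbb R$ with $I_p(f)<\infty$, normed by $\|f\|_{D_p}=\bigl(I_p(f)+|f(e)|^p\bigr)^{1/p}$, where $e$ is the identity of $\Gamma$. Let $D_p(\Gamma)/\mathbb R$ be its quotient by the constant functions, with the quotient norm $\|[f]\|=I_p(f)^{1/p}$. Let $BD_p(\Gamma)$ be the real algebra of bounded functions in $D_p(\Gamma)$ under pointwise operations, and let $Sp(BD_p(\Gamma))$ be the set of its characters, i.e. of nonzero ($\mathbb R$-linear and multiplicative) homomorphisms $\tau:BD_p(\Gamma)\to\mathbb C$. For $x\in\Gamma$ let $i(x)$ be the character $f\mapsto f(x)$. The $p$-harmonic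 boundary $\partial_p(\Gamma)$ is the set of all $\tau\in Sp(BD_p(\Gamma))\setminus i(\Gamma)$ such that $\tau(f)=0$ for every bounded $f$ in the $\|\cdot\|_{D_p}$-closure of the finitely supported functions in $D_p(\Gamma)$. For $f:\Gamma\to\mathbb R$ and $x\in\Gamma$ let $f_x(g)=f(gx^{-1})$. The map $[f]\mapsto[f_x]$ is well defined on $D_p(\Gamma)/\mathbb R$, and a linear functional $T$ on $D_p(\Gamma)/\mathbb R$ is called translation invariant if $T([f_x])=T([f])$ for all $f\in D_p(\Gamma)$ and $x\in\Gamma$. Theorem. The set $\partial_p(\Gamma)$ has more than one point if and only if there exists a nonzero continuous translation invariant linear functional $T: D_p(\Gamma)/\mathbb R\to\mathbb R$. -/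

import Mathlib

namespace PHarmonic

noncomputable section

/-! ### `p`-Dirichlet finite functions on a graph -/

/-- `f` is `p`-Dirichlet finite: `∑_{x} ∑_{y ∈ N_x} |f y - f x| ^ p < ∞`.
A dart of `G` is an ordered pair `(x, y)` of vertices with `y` a neighbour of `x`. -/
def IsDirichletFinite {V : Type*} (G : SimpleGraph V) (p : ℝ) (f : V → ℝ) : Prop :=
  Summable fun d : G.Dart => |f d.snd - f d.fst| ^ p

/-- The `p`-Dirichlet sum `I_p(f, V) = ∑_{x} ∑_{y ∈ N_x} |f y - f x| ^ p`. -/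
def dirichletSum {V : Type*} (G : SimpleGraph V) (p : ℝ) (f : V → ℝ) : ℝ :=
  ∑' d : G.Dart, |f d.snd - f d.fst| ^ p

theorem summable_abs_rpow_mono {ι : Type*} {p : ℝ} (hp : 0 ≤ p) {a b : ι → ℝ}
    (hb : Summable fun i => |b i| ^ p) (hab : ∀ j, |a j| ≤ |b j|) :
    Summable fun j => |a j| ^ p :=
  Summable.of_nonneg_of_le (fun _ => Real.rpow_nonneg (abs_nonneg _) _)
    (fun i => Real.rpow_le_rpow (abs_nonneg _) (hab i) hp) hb

theorem summable_abs_rpow_add {ι : Type*} {p : ℝ} (hp : 1 ≤ p) {a b : ι → ℝ}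
    (ha : Summable fun i => |a i| ^ p) (hb : Summable fun i => |b i| ^ p) :
    Summable fun i => |a i + b i| ^ p := by
  have h := Real.summable_Lp_add_of_nonneg hp (fun i => abs_nonneg (a i))
    (fun i => abs_nonneg (b i)) ha hb
  exact Summable.of_nonneg_of_le (fun i => Real.rpow_nonneg (abs_nonneg _) _)
    (fun i => Real.rpow_le_rpow (abs_nonneg _) (abs_add_le _ _) (by linarith)) h

theorem summable_abs_rpow_mul {ι : Type*} {p : ℝ} (c : ℝ) {a : ι → ℝ}
    (ha : Summable fun i => |a i| ^ p) : Summable fun i => |c * a i| ^ p := by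
  have h : (fun i => |c * a i| ^ p) = fun i => |c| ^ p * |a i| ^ p := by
    funext i
    rw [abs_mul, Real.mul_rpow (abs_nonneg _) (abs_nonneg _)]
  rw [h]
  exact ha.mul_left _

section Graph

variable {V : Type*} (G : SimpleGraph V) (p : ℝ)

theorem IsDirichletFinite.const [hp : Fact (1 < p)] (c : ℝ) :
    IsDirichletFinite G p fun _ => c := by
  have h0 : p ≠ 0 := by linarith [hp.out]
  simp [IsDirichletFinite, Real.zero_rpow h0]

variable {G p}

theorem IsDirichletFinite.add [hp : Fact (1 < p)] {f h : V → ℝ}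
    (hf : IsDirichletFinite G p f) (hh : IsDirichletFinite G p h) :
    IsDirichletFinite G p (f + h) := by
  refine (summable_abs_rpow_add hp.out.le hf hh).congr fun d => ?_
  simp only [Pi.add_apply]
  ring_nf

theorem IsDirichletFinite.smul {f : V → ℝ} (c : ℝ)
    (hf : IsDirichletFinite G p f) : IsDirichletFinite G p (c • f) := by
  refine (summable_abs_rpow_mul c hf).congr fun d => ?_
  simp only [Pi.smul_apply, smul_eq_mul]
  ring_nf

theorem IsDirichletFinite.mul [hp : Fact (1 < p)] {f h : V → ℝ}
    (hf : IsDirichletFinite G p f) (hh : IsDirichletFinite G p h)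
    (bf : ∃ C, ∀ x, |f x| ≤ C) (bh : ∃ C, ∀ x, |h x| ≤ C) :
    IsDirichletFinite G p (f * h) := by
  obtain ⟨a, ha⟩ := bf
  obtain ⟨b, hb⟩ := bh
  have h1 : Summable fun d : G.Dart => |h d.snd * (f d.snd - f d.fst)| ^ p := by
    refine summable_abs_rpow_mono (by linarith [hp.out]) (summable_abs_rpow_mul b hf) fun d => ?_
    rw [abs_mul, abs_mul]
    exact mul_le_mul_of_nonneg_right ((hb _).trans (le_abs_self b)) (abs_nonneg _)
  have h2 : Summable fun d : G.Dart => |f d.fst * (h d.snd - h d.fst)| ^ p := by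
    refine summable_abs_rpow_mono (by linarith [hp.out]) (summable_abs_rpow_mul a hh) fun d => ?_
    rw [abs_mul, abs_mul]
    exact mul_le_mul_of_nonneg_right ((ha _).trans (le_abs_self a)) (abs_nonneg _)
  refine (summable_abs_rpow_add hp.out.le h1 h2).congr fun d => ?_
  simp only [Pi.mul_apply]
  ring_nf

variable (G p)

/-- The set `D_p(G)` of `p`-Dirichlet finite functions, as a vector space of functions. -/
def dirichletSubmodule [Fact (1 < p)] : Submodule ℝ (V → ℝ) where
  carrier := {f | IsDirichletFinite G p f}
  add_mem' hf hh := hf.add hh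
  zero_mem' := IsDirichletFinite.const G p 0
  smul_mem' c _ hf := hf.smul c

/-- The algebra `BD_p(G)` of bounded `p`-Dirichlet finite functions, with pointwise operations. -/
def boundedDirichlet [Fact (1 < p)] : Subalgebra ℝ (V → ℝ) where
  carrier := {f | IsDirichletFinite G p f ∧ ∃ C, ∀ x, |f x| ≤ C}
  add_mem' := by
    rintro f h ⟨hf, a, ha⟩ ⟨hh, b, hb⟩
    exact ⟨hf.add hh, a + b, fun x => (abs_add_le _ _).trans (add_le_add (ha x) (hb x))⟩
  mul_mem' := by
    rintro f h ⟨hf, a, ha⟩ ⟨hh, b, hb⟩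
    refine ⟨hf.mul hh ⟨a, ha⟩ ⟨b, hb⟩, a * b, fun x => ?_⟩
    rw [Pi.mul_apply, abs_mul]
    exact mul_le_mul (ha x) (hb x) (abs_nonneg _) ((abs_nonneg _).trans (ha x))
  algebraMap_mem' r := ⟨IsDirichletFinite.const G p r, |r|, fun _ => le_rfl⟩

/-! ### The norm of `D_p(G)` -/

theorem dirichletSum_nonneg {V : Type*} {G : SimpleGraph V} {p : ℝ} (f : V → ℝ) : 0 ≤ dirichletSum G p f :=
  tsum_nonneg fun _ => Real.rpow_nonneg (abs_nonneg _) _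

/-- `D_p(G)`, to be normed with the help of the base vertex `o`.  (A type synonym, so that it
does not inherit the topology of pointwise convergence from the space of all functions.) -/
def DirichletSpace [Fact (1 < p)] (_o : V) : Type _ := dirichletSubmodule G p

namespace DirichletSpace

variable {G p} [Fact (1 < p)] {o : V}

instance : AddCommGroup (DirichletSpace G p o) :=
  inferInstanceAs (AddCommGroup (dirichletSubmodule G p))

instance : Module ℝ (DirichletSpace G p o) :=
  inferInstanceAs (Module ℝ (dirichletSubmodule G p))

/-- The function underlying an element of `D_p(G)`. -/
def toFun (f : DirichletSpace G p o) : V → ℝ := f.1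

/-- A `p`-Dirichlet finite function as an element of `D_p(G)`. -/
def mk (f : V → ℝ) (hf : IsDirichletFinite G p f) : DirichletSpace G p o := ⟨f, hf⟩

theorem ext {f h : DirichletSpace G p o} (H : f.toFun = h.toFun) : f = h := Subtype.ext H

/-- `‖f‖ = (I_p(f, V) + |f(o)| ^ p) ^ (1 / p)`. -/
instance : Norm (DirichletSpace G p o) :=
  ⟨fun f => (dirichletSum G p f.toFun + |f.toFun o| ^ p) ^ (1 / p)⟩

theorem norm_def (f : DirichletSpace G p o) :
    ‖f‖ = (dirichletSum G p f.toFun + |f.toFun o| ^ p) ^ (1 / p) := rfl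

theorem seminormedCore : SeminormedSpace.Core ℝ (DirichletSpace G p o) where
  norm_nonneg f := Real.rpow_nonneg
    (add_nonneg (dirichletSum_nonneg _) (Real.rpow_nonneg (abs_nonneg _) _)) _
  norm_smul c f := by
    have hp : (1 : ℝ) < p := Fact.out
    have h1 : dirichletSum G p (c • f).toFun = |c| ^ p * dirichletSum G p f.toFun := by
      rw [dirichletSum, dirichletSum, ← tsum_mul_left]
      refine tsum_congr fun d => ?_
      rw [← Real.mul_rpow (abs_nonneg _) (abs_nonneg _), ← abs_mul, mul_sub]
      rfl
    have h2 : |(c • f).toFun o| ^ p = |c| ^ p * |f.toFun o| ^ p := by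
      rw [← Real.mul_rpow (abs_nonneg _) (abs_nonneg _), ← abs_mul]
      rfl
    rw [norm_def, norm_def, h1, h2, ← mul_add, Real.mul_rpow
      (Real.rpow_nonneg (abs_nonneg _) _)
      (add_nonneg (dirichletSum_nonneg _) (Real.rpow_nonneg (abs_nonneg _) _)),
      ← Real.rpow_mul (abs_nonneg _), mul_one_div_cancel (by linarith), Real.rpow_one,
      Real.norm_eq_abs]
  norm_triangle f h := by
    have hp : (1 : ℝ) < p := Fact.out
    have hp0 : p ≠ 0 := by linarith
    set A := dirichletSum G p f.toFun with hA
    set B := dirichletSum G p h.toFun with hB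
    have hA0 : 0 ≤ A := dirichletSum_nonneg _
    have hB0 : 0 ≤ B := dirichletSum_nonneg _
    have hAB : dirichletSum G p (f + h).toFun ≤ |A ^ (1 / p) + B ^ (1 / p)| ^ p := by
      obtain ⟨hs, hle⟩ := Real.Lp_add_le_tsum_of_nonneg hp.le
        (fun d : G.Dart => abs_nonneg (f.toFun d.snd - f.toFun d.fst))
        (fun d : G.Dart => abs_nonneg (h.toFun d.snd - h.toFun d.fst)) f.2 h.2
      have hle' : dirichletSum G p (f + h).toFun ≤
          ∑' d : G.Dart, (|f.toFun d.snd - f.toFun d.fst| +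
            |h.toFun d.snd - h.toFun d.fst|) ^ p := by
        refine Summable.tsum_le_tsum (fun d => ?_) (f + h).2 hs
        refine Real.rpow_le_rpow (abs_nonneg _) ?_ (by linarith)
        have : (f + h).toFun d.snd - (f + h).toFun d.fst =
            (f.toFun d.snd - f.toFun d.fst) + (h.toFun d.snd - h.toFun d.fst) := by
          change (f.toFun d.snd + h.toFun d.snd) - (f.toFun d.fst + h.toFun d.fst) = _
          ring
        rw [this]
        exact abs_add_le _ _
      have hsum0 : 0 ≤ ∑' d : G.Dart, (|f.toFun d.snd - f.toFun d.fst| +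
            |h.toFun d.snd - h.toFun d.fst|) ^ p :=
        tsum_nonneg fun d => Real.rpow_nonneg (by positivity) _
      refine hle'.trans ?_
      have h3 := Real.rpow_le_rpow (Real.rpow_nonneg hsum0 _) hle (by linarith : 0 ≤ p)
      rw [← Real.rpow_mul hsum0, one_div_mul_cancel hp0, Real.rpow_one] at h3
      exact h3.trans (Real.rpow_le_rpow
        (add_nonneg (Real.rpow_nonneg hA0 _) (Real.rpow_nonneg hB0 _)) (le_abs_self _)
        (by linarith))
    have key := Real.Lp_add_le (Finset.univ : Finset (Fin 2))
      ![A ^ (1 / p), f.toFun o] ![B ^ (1 / p), h.toFun o] hp.le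
    simp only [Fin.sum_univ_two, Matrix.cons_val_zero, Matrix.cons_val_one] at key
    have e1 : |A ^ (1 / p)| ^ p = A := by
      rw [abs_of_nonneg (Real.rpow_nonneg hA0 _), ← Real.rpow_mul hA0,
        one_div_mul_cancel hp0, Real.rpow_one]
    have e2 : |B ^ (1 / p)| ^ p = B := by
      rw [abs_of_nonneg (Real.rpow_nonneg hB0 _), ← Real.rpow_mul hB0,
        one_div_mul_cancel hp0, Real.rpow_one]
    rw [e1, e2] at key
    refine le_trans ?_ key
    refine Real.rpow_le_rpow
      (add_nonneg (dirichletSum_nonneg _) (Real.rpow_nonneg (abs_nonneg _) _))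
      (add_le_add hAB le_rfl) (by positivity)

/-- `D_p(G)` as a normed space.  (For a connected graph `‖f‖ = 0` forces `f = 0`; this is not
needed to speak of its topology.) -/
instance : SeminormedAddCommGroup (DirichletSpace G p o) :=
  SeminormedAddCommGroup.ofCore (𝕜 := ℝ) seminormedCore

instance : NormedSpace ℝ (DirichletSpace G p o) where
  norm_smul_le c f := (seminormedCore.norm_smul c f).le

end DirichletSpace

/-! ### The `p`-harmonic boundary -/

section Boundary

variable [Fact (1 < p)]

/-- A bounded `p`-Dirichlet finite function as an element of the normed space `D_p(G)`. -/
def boundedDirichlet.toDirichletSpace (o : V) (f : boundedDirichlet G p) :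
    DirichletSpace G p o := .mk f.1 f.2.1

/-- `Sp(BD_p(G))`: the characters of the real algebra `BD_p(G)`, that is, its nonzero
homomorphisms into `ℂ` (a homomorphism into a field is nonzero iff it maps `1` to `1`). -/
abbrev Character : Type _ := boundedDirichlet G p →ₐ[ℝ] ℂ

/-- The embedding `i : V → Sp(BD_p(G))`, `i(x)(f) = f(x)`. -/
def vertexCharacter (x : V) : Character G p :=
  (Complex.ofRealAm.comp (Pi.evalAlgHom ℝ (fun _ : V => ℝ) x)).comp (boundedDirichlet G p).val

/-- The `p`-Royden boundary `R_p(G) = Sp(BD_p(G)) \ i(V)`. -/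
def roydenBoundary : Set (Character G p) := (Set.range (vertexCharacter G p))ᶜ

/-- The closure in `D_p(G)` of the set of finitely supported (`p`-Dirichlet finite) functions.
On a locally finite graph every finitely supported function is `p`-Dirichlet finite. -/
def closureFiniteSupport (o : V) : Set (DirichletSpace G p o) :=
  closure {f | f.toFun.support.Finite}

/-- The `p`-harmonic boundary `∂_p(G)`: the points of the `p`-Royden boundary at which `f̂`
vanishes for every bounded `f` in the `D_p`-closure of the finitely supported functions. -/
def harmonicBoundary (o : V) : Set (Character G p) :=
  {τ | τ ∈ roydenBoundary G p ∧
    ∀ f : boundedDirichlet G p,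
      boundedDirichlet.toDirichletSpace G p o f ∈ closureFiniteSupport G p o → τ f = 0}

end Boundary

end Graph

/-! ### Translation invariant functionals on `D_p(Γ) / ℝ` -/

section Group

variable {Γ : Type*} [Group Γ] {S : Set Γ} {p : ℝ}

/-- Over a finite generating set, `f` is `p`-Dirichlet finite on the Cayley graph iff every
difference `g ↦ f (g * t) - f g` is `p`-summable. -/
theorem isDirichletFinite_cayley_iff [hp : Fact (1 < p)] (hS : S.Finite)
    (hgen : Subgroup.closure S = ⊤) (f : Γ → ℝ) :
    IsDirichletFinite (SimpleGraph.mulCayley S) p f ↔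
      ∀ t : Γ, Summable fun g => |f (g * t) - f g| ^ p := by
  have hp0 : p ≠ 0 := by linarith [hp.out]
  constructor
  · intro hf t
    have ht : t ∈ Subgroup.closure S := by rw [hgen]; trivial
    induction ht using Subgroup.closure_induction with
    | mem s hs =>
      by_cases h1 : s = 1
      · simp [h1, Real.zero_rpow hp0]
      · let e : Γ → (SimpleGraph.mulCayley S).Dart := fun g =>
          ⟨(g, g * s), by
            rw [SimpleGraph.mulCayley_adj']
            exact ⟨by simpa using h1, s, hs, Or.inl rfl⟩⟩
        have he : Function.Injective e := fun a b hab =>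
          congrArg (fun d : (SimpleGraph.mulCayley S).Dart => d.fst) hab
        have hsum : Summable fun g => |f (e g).snd - f (e g).fst| ^ p :=
          Summable.comp_injective hf he
        exact hsum
    | one => simp [Real.zero_rpow hp0]
    | mul x y _ _ hx hy =>
      have hy' : Summable fun g => |f (g * x * y) - f (g * x)| ^ p :=
        hy.comp_injective (i := fun g => g * x) (mul_left_injective x)
      refine (summable_abs_rpow_add hp.out.le hy' hx).congr fun g => ?_
      rw [sub_add_sub_cancel, mul_assoc]
    | inv x _ hx =>
      have hx' : Summable fun g => |f (g * x⁻¹ * x) - f (g * x⁻¹)| ^ p :=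
        hx.comp_injective (i := fun g => g * x⁻¹) (mul_left_injective x⁻¹)
      refine hx'.congr fun g => ?_
      rw [inv_mul_cancel_right, abs_sub_comm]
  · intro H
    have hadj : ∀ d : (SimpleGraph.mulCayley S).Dart,
        ∃ t : (S ∪ S⁻¹ : Set Γ), d.snd = d.fst * t := by
      intro d
      obtain ⟨-, g, hg, h | h⟩ := (SimpleGraph.mulCayley_adj' S _ _).mp d.adj
      · exact ⟨⟨g, Or.inl hg⟩, h.symm⟩
      · exact ⟨⟨g⁻¹, Or.inr (by simpa using hg)⟩, by rw [eq_mul_inv_iff_mul_eq]; exact h.symm⟩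
    choose t ht using hadj
    have : Finite (S ∪ S⁻¹ : Set Γ) := (hS.union hS.inv).to_subtype
    have hsum : Summable fun q : (S ∪ S⁻¹ : Set Γ) × Γ => |f (q.2 * q.1) - f q.2| ^ p := by
      rw [summable_prod_of_nonneg fun q => Real.rpow_nonneg (abs_nonneg _) _]
      exact ⟨fun x => H x, Summable.of_finite⟩
    have he : Function.Injective fun d : (SimpleGraph.mulCayley S).Dart => (t d, d.fst) := by
      intro d d' h
      simp only [Prod.mk.injEq] at h
      apply SimpleGraph.Dart.ext
      apply Prod.ext
      · exact h.2
      · have h1 := ht d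
        rw [h.1, h.2, ← ht d'] at h1
        exact h1
    refine (hsum.comp_injective he).congr fun d => ?_
    simp only [Function.comp, ← ht]

theorem isDirichletFinite_translate [Fact (1 < p)] (hS : S.Finite)
    (hgen : Subgroup.closure S = ⊤) (x : Γ) {f : Γ → ℝ}
    (hf : IsDirichletFinite (SimpleGraph.mulCayley S) p f) :
    IsDirichletFinite (SimpleGraph.mulCayley S) p fun g => f (g * x⁻¹) := by
  rw [isDirichletFinite_cayley_iff hS hgen] at hf ⊢
  intro t
  have h : Summable fun g => |f (g * x⁻¹ * (x * t * x⁻¹)) - f (g * x⁻¹)| ^ p :=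
    (hf (x * t * x⁻¹)).comp_injective (i := fun g => g * x⁻¹) (mul_left_injective x⁻¹)
  refine h.congr fun g => ?_
  simp [mul_assoc]

variable (S p)

/-- `D_p(Γ)`, the space `D_p` of the Cayley graph of `Γ` with respect to `S`, based at `1`:
two distinct elements `x₁, x₂` are joined by an edge iff `x₁ = x₂ s` or `x₂ = x₁ s` for some
`s ∈ S`. -/
abbrev GroupDirichletSpace [Fact (1 < p)] : Type _ :=
  DirichletSpace (SimpleGraph.mulCayley S) p (1 : Γ)

/-- The subspace `ℝ ⊆ D_p(Γ)` of constant functions. -/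
def constants [Fact (1 < p)] : Submodule ℝ (GroupDirichletSpace S p) where
  carrier := {f | ∃ c : ℝ, ∀ g, f.toFun g = c}
  add_mem' := by
    rintro f h ⟨a, ha⟩ ⟨b, hb⟩
    exact ⟨a + b, fun g => congrArg₂ (· + ·) (ha g) (hb g)⟩
  zero_mem' := ⟨0, fun _ => rfl⟩
  smul_mem' := by
    rintro c f ⟨a, ha⟩
    exact ⟨c * a, fun g => congrArg (c * ·) (ha g)⟩

/-- `D_p(Γ) / ℝ` with the quotient norm, which is `‖[f]‖ = I_p(f, Γ) ^ (1 / p)`. -/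
abbrev DirichletModConstants [Fact (1 < p)] : Type _ :=
  GroupDirichletSpace S p ⧸ constants S p

variable {S p}

/-- Right translation `f ↦ f_x`, `f_x(g) = f(g x⁻¹)`, on `D_p(Γ)`. -/
def translate [Fact (1 < p)] (hS : S.Finite) (hgen : Subgroup.closure S = ⊤) (x : Γ) :
    GroupDirichletSpace S p →ₗ[ℝ] GroupDirichletSpace S p where
  toFun f := .mk (fun g => f.toFun (g * x⁻¹)) (isDirichletFinite_translate hS hgen x f.2)
  map_add' _ _ := rfl
  map_smul' _ _ := rfl

/-- Right translation on `D_p(Γ) / ℝ`: `[f]_x = [f_x]`. -/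
def translateQuotient [Fact (1 < p)] (hS : S.Finite) (hgen : Subgroup.closure S = ⊤) (x : Γ) :
    DirichletModConstants S p →ₗ[ℝ] DirichletModConstants S p :=
  (constants S p).mapQ (constants S p) (translate hS hgen x)
    (fun _ ⟨c, hc⟩ => ⟨c, fun g => hc (g * x⁻¹)⟩)

/-- `T` is translation invariant on `D_p(Γ) / ℝ`: `T([f]_x) = T([f])` for all `f` and `x`. -/
def IsTranslationInvariant [Fact (1 < p)] (hS : S.Finite) (hgen : Subgroup.closure S = ⊤)
    (T : DirichletModConstants S p →ₗ[ℝ] ℝ) : Prop :=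
  ∀ (x : Γ) (φ : DirichletModConstants S p), T (translateQuotient hS hgen x φ) = T φ

end Group

end

end PHarmonic

namespace PHarmonic

open Filter Topology

/-! Let F be the closure of the finitely supported functions in D_p(Γ). Both sides of the
equivalence say that some bounded f satisfies f - c ∉ F for every constant c.

Functionals: a continuous functional on D_p(Γ) is translation invariant exactly when it kills all
point masses. Invariance gives every point mass the same value a. A function with values 1/n along a
sequence of distinct points is in ℓ^p, so it is the sum in D_p(Γ) of its point masses; applying the
functional makes the series of a/n converge, hence a = 0. Conversely, f_x - f is in ℓ^p, hence a sum
of multiples of point masses, and is killed. The functionals in question are therefore those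
vanishing on F and on constants; Hahn–Banach provides them, and density of bounded functions lets a
nonzero one be detected on a bounded f.

Boundary: two distinct boundary characters differ at some f, and then no f - c lies in F, since both
would give f the value c. The converse needs a supply of characters. The bounded elements of F form
an ideal, and the sets where such an element is small form a filter. A bounded Dirichlet finite
function tends to 0 along this filter iff it lies in F (`tendsto_nullFilter`,
`mem_nullIdeal_of_tendsto`). If no f - c is in F, then f has no limit along the filter, so two finer
ultrafilters give f different limits, and limits along such ultrafilters are boundary characters. -/

/-- The truncation of `t` to the interval `[-M, M]`. -/
noncomputable def clamp (M t : ℝ) : ℝ := max (min t M) (-M)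

theorem abs_clamp_sub_clamp_le (M s t : ℝ) : |clamp M s - clamp M t| ≤ |s - t| := by
  refine (abs_max_sub_max_le_abs _ _ _).trans ?_
  simpa using abs_min_sub_min_le_max s M t M

theorem abs_clamp_le {M : ℝ} (hM : 0 ≤ M) (t : ℝ) : |clamp M t| ≤ M :=
  abs_le.mpr ⟨le_max_right _ _, max_le (min_le_right _ _) (by linarith)⟩

theorem clamp_eq_self {M t : ℝ} (h : |t| ≤ M) : clamp M t = t := by
  obtain ⟨h1, h2⟩ := abs_le.mp h
  rw [clamp, min_eq_left h2, max_eq_left h1]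

theorem continuous_clamp (M : ℝ) : Continuous (clamp M) :=
  (continuous_id.min continuous_const).max continuous_const

/-! ### Dominated convergence and truncation in D_p(G) -/

section Graph

variable {V : Type*} {G : SimpleGraph V} {p : ℝ}

/-- A function whose differences are dominated by those of a `p`-Dirichlet finite function is
`p`-Dirichlet finite. -/
theorem IsDirichletFinite.of_abs_sub_le [hp : Fact (1 < p)] {f h : V → ℝ} (K : ℝ)
    (hf : IsDirichletFinite G p f) (H : ∀ x y, |h y - h x| ≤ K * |f y - f x|) :
    IsDirichletFinite G p h := by
  refine summable_abs_rpow_mono (by linarith [hp.out]) (summable_abs_rpow_mul K hf) fun d => ?_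
  rw [abs_mul]
  exact (H _ _).trans (mul_le_mul_of_nonneg_right (le_abs_self K) (abs_nonneg _))

theorem IsDirichletFinite.clamp [Fact (1 < p)] {f : V → ℝ} (M : ℝ)
    (hf : IsDirichletFinite G p f) : IsDirichletFinite G p fun x => clamp M (f x) :=
  hf.of_abs_sub_le 1 fun x y => by simpa using abs_clamp_sub_clamp_le M (f y) (f x)

/-- A dominated convergence theorem for `p`-th powers, where the bound is the sum of a fixed
`p`-summable function and a family tending to zero in `ℓ^p`. -/
theorem tendsto_tsum_abs_rpow_zero {ι α : Type*} {l : Filter α} (hp : 0 < p)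
    {a u : α → ι → ℝ} {b : ι → ℝ} (hb0 : ∀ i, 0 ≤ b i) (hb : Summable fun i => |b i| ^ p)
    (hu : ∀ n, Summable fun i => |u n i| ^ p)
    (hu0 : Tendsto (fun n => ∑' i, |u n i| ^ p) l (𝓝 0))
    (hab : ∀ᶠ n in l, ∀ i, |a n i| ≤ |u n i| + b i)
    (ha : ∀ i, Tendsto (fun n => a n i) l (𝓝 0)) :
    Tendsto (fun n => ∑' i, |a n i| ^ p) l (𝓝 0) := by
  -- Split at 2b: where |a| ≤ 2b, ordinary dominated convergence applies to the minimum; where |a| >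
  -- 2b, the bound |a| ≤ |u| + b forces |a| ≤ 2|u|, which is small in ℓ^p.
  have hm : Tendsto (fun n => ∑' i, (min |a n i| (2 * b i)) ^ p) l (𝓝 (∑' _ : ι, (0 : ℝ))) := by
    refine tendsto_tsum_of_dominated_convergence (bound := fun i => |2 * b i| ^ p)
      (summable_abs_rpow_mul 2 hb) (fun i => ?_) (Eventually.of_forall fun n i => ?_)
    · have h1 : Tendsto (fun n => min |a n i| (2 * b i)) l (𝓝 0) := by
        have := (ha i).abs.min (tendsto_const_nhds (x := 2 * b i))
        simpa [hb0 i] using this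
      simpa [Real.zero_rpow hp.ne'] using h1.rpow_const (Or.inr hp.le)
    · have h0 : 0 ≤ min |a n i| (2 * b i) :=
        le_min (abs_nonneg _) (mul_nonneg zero_le_two (hb0 i))
      rw [Real.norm_eq_abs, abs_of_nonneg (Real.rpow_nonneg h0 _)]
      exact Real.rpow_le_rpow h0 ((min_le_right _ _).trans (le_abs_self _)) hp.le
  have hsum : Tendsto (fun n => ∑' i, (min |a n i| (2 * b i)) ^ p + 2 ^ p * ∑' i, |u n i| ^ p) l
      (𝓝 0) := by
    simpa using hm.add (hu0.const_mul (2 ^ p))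
  refine squeeze_zero' (Eventually.of_forall fun n =>
    tsum_nonneg fun i => Real.rpow_nonneg (abs_nonneg _) _) ?_ hsum
  filter_upwards [hab] with n hn
  have hpt : ∀ i, |a n i| ^ p ≤ (min |a n i| (2 * b i)) ^ p + 2 ^ p * |u n i| ^ p := by
    intro i
    have h0 : 0 ≤ min |a n i| (2 * b i) :=
      le_min (abs_nonneg _) (mul_nonneg zero_le_two (hb0 i))
    rcases le_total |a n i| (2 * b i) with h | h
    · rw [min_eq_left h]
      exact le_add_of_nonneg_right (by positivity)
    · refine le_add_of_nonneg_of_le (Real.rpow_nonneg h0 _) ?_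
      rw [← Real.mul_rpow zero_le_two (abs_nonneg _)]
      exact Real.rpow_le_rpow (abs_nonneg _) (by linarith [hn i]) hp.le
  have hs1 : Summable fun i => (min |a n i| (2 * b i)) ^ p := by
    refine Summable.of_nonneg_of_le (fun i => Real.rpow_nonneg (le_min (abs_nonneg _)
      (mul_nonneg zero_le_two (hb0 i))) _) (fun i => ?_) (summable_abs_rpow_mul 2 hb)
    exact Real.rpow_le_rpow (le_min (abs_nonneg _) (mul_nonneg zero_le_two (hb0 i)))
      ((min_le_right _ _).trans (le_abs_self _)) hp.le
  have hs2 := (hu n).mul_left (2 ^ p)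
  have hs := hs1.add hs2
  rw [← tsum_mul_left, ← hs1.tsum_add hs2]
  exact Summable.tsum_le_tsum hpt
    (Summable.of_nonneg_of_le (fun i => Real.rpow_nonneg (abs_nonneg _) _) hpt hs) hs

namespace DirichletSpace

variable [Fact (1 < p)] {o : V}

theorem isDirichletFinite (f : DirichletSpace G p o) : IsDirichletFinite G p f.toFun := f.2

theorem norm_rpow (f : DirichletSpace G p o) :
    ‖f‖ ^ p = dirichletSum G p f.toFun + |f.toFun o| ^ p := by
  have hp : (1 : ℝ) < p := Fact.out
  rw [norm_def, ← Real.rpow_mul (add_nonneg (dirichletSum_nonneg _)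
    (Real.rpow_nonneg (abs_nonneg _) _)), one_div_mul_cancel (by linarith), Real.rpow_one]

theorem abs_apply_base_le (f : DirichletSpace G p o) : |f.toFun o| ≤ ‖f‖ := by
  have hp : (1 : ℝ) < p := Fact.out
  rw [← Real.rpow_le_rpow_iff (abs_nonneg _) (norm_nonneg _) (by linarith : 0 < p), norm_rpow]
  exact le_add_of_nonneg_left (dirichletSum_nonneg _)

theorem abs_sub_le_norm (f : DirichletSpace G p o) (d : G.Dart) :
    |f.toFun d.snd - f.toFun d.fst| ≤ ‖f‖ := by
  have hp : (1 : ℝ) < p := Fact.out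
  rw [← Real.rpow_le_rpow_iff (abs_nonneg _) (norm_nonneg _) (by linarith : 0 < p), norm_rpow]
  refine le_add_of_le_of_nonneg ?_ (Real.rpow_nonneg (abs_nonneg _) _)
  exact Summable.le_tsum (f := fun d : G.Dart => |f.toFun d.snd - f.toFun d.fst| ^ p) f.2 d
    fun _ _ => Real.rpow_nonneg (abs_nonneg _) _

theorem tendsto_dirichletSum {α : Type*} {l : Filter α} {F : α → DirichletSpace G p o}
    (h : Tendsto F l (𝓝 0)) : Tendsto (fun n => dirichletSum G p (F n).toFun) l (𝓝 0) := by
  have hp : (1 : ℝ) < p := Fact.out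
  have h1 : Tendsto (fun n => ‖F n‖ ^ p) l (𝓝 0) := by
    have := (tendsto_zero_iff_norm_tendsto_zero.mp h).rpow_const (p := p)
      (Or.inr (by linarith))
    rwa [Real.zero_rpow (by linarith)] at this
  refine squeeze_zero (fun n => dirichletSum_nonneg _) (fun n => ?_) h1
  rw [norm_rpow]
  exact le_add_of_nonneg_right (Real.rpow_nonneg (abs_nonneg _) _)

/-- Dominated convergence in `D_p(G)`. -/
theorem tendsto_of_dominated {α : Type*} {l : Filter α} {F U : α → DirichletSpace G p o}
    {f : DirichletSpace G p o} {b : G.Dart → ℝ} (hb0 : ∀ d, 0 ≤ b d)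
    (hb : Summable fun d => |b d| ^ p) (hU : Tendsto U l (𝓝 0))
    (hbound : ∀ᶠ n in l, ∀ d : G.Dart,
      |((F n).toFun d.snd - f.toFun d.snd) - ((F n).toFun d.fst - f.toFun d.fst)| ≤
        |(U n).toFun d.snd - (U n).toFun d.fst| + b d)
    (hF : ∀ x, Tendsto (fun n => (F n).toFun x) l (𝓝 (f.toFun x))) : Tendsto F l (𝓝 f) := by
  have hp : (1 : ℝ) < p := Fact.out
  have hF0 : ∀ x, Tendsto (fun n => (F n).toFun x - f.toFun x) l (𝓝 0) := fun x => by
    simpa using (hF x).sub_const (f.toFun x)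
  have h1 : Tendsto (fun n => dirichletSum G p (F n - f).toFun) l (𝓝 0) :=
    tendsto_tsum_abs_rpow_zero (by linarith) hb0 hb (fun n => (U n).2)
      (tendsto_dirichletSum hU) hbound fun d => by
        have := (hF0 d.snd).sub (hF0 d.fst)
        rwa [sub_zero] at this
  have h2 : Tendsto (fun n => |(F n - f).toFun o| ^ p) l (𝓝 0) := by
    have := (hF0 o).abs.rpow_const (p := p) (Or.inr (by linarith))
    rwa [abs_zero, Real.zero_rpow (by linarith)] at this
  rw [tendsto_iff_norm_sub_tendsto_zero]
  have h3 := (h1.add h2).rpow_const (p := 1 / p) (Or.inr (by positivity))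
  rwa [add_zero, Real.zero_rpow (by positivity)] at h3

/-- Each edge of a walk from x to the base vertex costs at most ‖f‖, so evaluation at x is bounded
by a multiple of the norm. Hence norm convergence implies pointwise convergence on a connected
graph. -/
theorem exists_abs_apply_le (hG : G.Preconnected) (x : V) :
    ∃ C : ℝ, ∀ f : DirichletSpace G p o, |f.toFun x| ≤ C * ‖f‖ := by
  obtain ⟨w⟩ := hG x o
  induction w with
  | nil => exact ⟨1, fun f => by simpa using abs_apply_base_le f⟩
  | @cons u v w h _ ih =>
    obtain ⟨C, hC⟩ := ih
    refine ⟨C + 1, fun f => ?_⟩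
    have h1 := abs_sub_le_norm f ⟨(v, u), h.symm⟩
    have h2 : |f.toFun u| ≤ |f.toFun u - f.toFun v| + |f.toFun v| := by
      simpa using abs_add_le (f.toFun u - f.toFun v) (f.toFun v)
    have h3 := hC f
    simp only at h1
    linarith

theorem tendsto_apply (hG : G.Preconnected) {α : Type*} {l : Filter α}
    {F : α → DirichletSpace G p o} {f : DirichletSpace G p o} (h : Tendsto F l (𝓝 f)) (x : V) :
    Tendsto (fun n => (F n).toFun x) l (𝓝 (f.toFun x)) := by
  obtain ⟨C, hC⟩ := exists_abs_apply_le (p := p) (o := o) hG x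
  rw [tendsto_iff_norm_sub_tendsto_zero] at h ⊢
  refine squeeze_zero (fun _ => norm_nonneg _) (fun n => hC (F n - f)) ?_
  simpa using h.const_mul C

/-- Bounded functions are dense in `D_p(G)`: truncations converge. -/
theorem tendsto_clamp (f : DirichletSpace G p o) :
    Tendsto (fun n : ℕ => (mk (fun x => clamp n (f.toFun x)) (f.2.clamp n) :
      DirichletSpace G p o)) atTop (𝓝 f) := by
  refine tendsto_of_dominated (U := 0) (b := fun d => |2 * (f.toFun d.snd - f.toFun d.fst)|)
    (fun _ => abs_nonneg _) ?_ tendsto_const_nhds ?_ ?_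
  · simpa only [abs_abs] using summable_abs_rpow_mul 2 f.isDirichletFinite
  · refine Eventually.of_forall fun n d => le_add_of_nonneg_of_le (abs_nonneg _) ?_
    have h1 := abs_clamp_sub_clamp_le n (f.toFun d.snd) (f.toFun d.fst)
    rw [abs_mul, abs_two, sub_sub_sub_comm]
    refine (abs_sub _ _).trans ?_
    simp only [mk, toFun] at h1 ⊢
    linarith
  · intro x
    refine tendsto_const_nhds.congr' ?_
    filter_upwards [eventually_ge_atTop ⌈|f.toFun x|⌉₊] with n hn
    exact (clamp_eq_self ((Nat.le_ceil _).trans (by exact_mod_cast hn))).symm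

/-- As `ε → 0`, the truncations to `[-ε, ε]` tend to zero. -/
theorem tendsto_clamp_zero (f : DirichletSpace G p o) :
    Tendsto (fun ε : ℝ => (mk (fun x => clamp ε (f.toFun x)) (f.2.clamp ε) :
      DirichletSpace G p o)) (𝓝[>] 0) (𝓝 0) := by
  refine tendsto_of_dominated (U := 0) (b := fun d => |f.toFun d.snd - f.toFun d.fst|)
    (fun _ => abs_nonneg _) ?_ tendsto_const_nhds ?_ ?_
  · simp only [abs_abs]
    exact f.2
  · refine Eventually.of_forall fun ε d => le_add_of_nonneg_of_le (abs_nonneg _) ?_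
    have h1 := abs_clamp_sub_clamp_le ε (f.toFun d.snd) (f.toFun d.fst)
    have h0 : ∀ x, (0 : DirichletSpace G p o).toFun x = 0 := fun _ => rfl
    simp only [h0, sub_zero]
    exact h1
  · intro x
    refine squeeze_zero_norm' (a := id) ?_ (tendsto_id.mono_left nhdsWithin_le_nhds)
    filter_upwards [self_mem_nhdsWithin] with ε hε
    exact abs_clamp_le (le_of_lt hε) _

variable (G p o) in
/-- The closure of the finitely supported functions, as a subspace of `D_p(G)`. -/
noncomputable def closureFinsupp : Submodule ℝ (DirichletSpace G p o) :=
  Submodule.topologicalClosure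
    { carrier := {f | f.toFun.support.Finite}
      add_mem' := fun {f h} hf hh => (hf.union hh).subset (Function.support_add f.toFun h.toFun)
      zero_mem' := by
        change (Function.support (0 : V → ℝ)).Finite
        simp
      smul_mem' := fun c f hf => Set.Finite.subset hf
        (Function.support_const_smul_subset c f.toFun) }

theorem isClosed_closureFinsupp : IsClosed (closureFinsupp G p o : Set (DirichletSpace G p o)) :=
  Submodule.isClosed_topologicalClosure _

theorem mem_closureFinsupp_of_finite {f : DirichletSpace G p o} (hf : f.toFun.support.Finite) :
    f ∈ closureFinsupp G p o := subset_closure hf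

end DirichletSpace

end Graph

/-! ### The null ideal, its filter, and boundary characters as ultrafilter limits -/

section Boundary

variable {V : Type*} {G : SimpleGraph V} {p : ℝ} [Fact (1 < p)] {o : V}

open DirichletSpace

/-- The bounded functions in the closure of the finitely supported functions form an ideal. -/
noncomputable def nullIdeal (hG : G.Preconnected) (p : ℝ) [Fact (1 < p)] (o : V) :
    Ideal (boundedDirichlet G p) where
  carrier := {h | boundedDirichlet.toDirichletSpace G p o h ∈ closureFinsupp G p o}
  add_mem' {f h} hf hh := (closureFinsupp G p o).add_mem hf hh
  zero_mem' := (closureFinsupp G p o).zero_mem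
  smul_mem' f h hh := by
    obtain ⟨C, hC⟩ := f.2.2
    obtain ⟨M, hM⟩ := h.2.2
    have hC0 : 0 ≤ C := (abs_nonneg _).trans (hC o)
    have hM0 : 0 ≤ M := (abs_nonneg _).trans (hM o)
    obtain ⟨u, hu, hlim⟩ := mem_closure_iff_seq_limit.mp hh
    -- Truncating the approximants at the bound M of h leaves the pointwise limit h unchanged and
    -- makes the factor multiplying the differences of f bounded.
    have hBD : ∀ n, (fun x => clamp M ((u n).toFun x)) ∈ boundedDirichlet G p := fun n =>
      ⟨(u n).isDirichletFinite.clamp M, M, fun x => abs_clamp_le hM0 _⟩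
    let F : ℕ → DirichletSpace G p o := fun n =>
      boundedDirichlet.toDirichletSpace G p o (f * ⟨_, hBD n⟩)
    have hF : ∀ n, F n ∈ closureFinsupp G p o := fun n => by
      refine mem_closureFinsupp_of_finite ((hu n).subset fun x hx hx0 => hx ?_)
      change f.1 x * clamp M ((u n).toFun x) = 0
      rw [hx0, clamp_eq_self (by simpa using hM0), mul_zero]
    change boundedDirichlet.toDirichletSpace G p o (f * h) ∈ closureFinsupp G p o
    refine isClosed_closureFinsupp.mem_of_tendsto (f := F) (b := atTop) ?_ (Eventually.of_forall hF)
    have hU : Tendsto (fun n => C • (u n - boundedDirichlet.toDirichletSpace G p o h)) atTop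
        (𝓝 0) := by
      simpa using (hlim.sub_const (boundedDirichlet.toDirichletSpace G p o h)).const_smul C
    refine tendsto_of_dominated (o := o) (hU := hU)
      (b := fun d => |2 * C * (h.1 d.snd - h.1 d.fst)| + |2 * M * (f.1 d.snd - f.1 d.fst)|)
      (fun d => add_nonneg (abs_nonneg _) (abs_nonneg _)) ?_ ?_ ?_
    · refine summable_abs_rpow_add (Fact.out : 1 < p).le ?_ ?_ <;> simp only [abs_abs]
      · exact summable_abs_rpow_mul _ h.2.1
      · exact summable_abs_rpow_mul _ f.2.1
    · refine Eventually.of_forall fun n d => ?_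
      change |(f.1 d.snd * clamp M ((u n).toFun d.snd) - f.1 d.snd * h.1 d.snd) -
        (f.1 d.fst * clamp M ((u n).toFun d.fst) - f.1 d.fst * h.1 d.fst)| ≤
        |C * ((u n).toFun d.snd - h.1 d.snd) - C * ((u n).toFun d.fst - h.1 d.fst)| + _
      have h1 := abs_clamp_sub_clamp_le M ((u n).toFun d.snd) ((u n).toFun d.fst)
      have h2 := abs_clamp_le hM0 ((u n).toFun d.fst)
      have h3 := hM d.fst
      have h4 := hC d.snd
      generalize clamp M ((u n).toFun d.snd) = a at *
      generalize clamp M ((u n).toFun d.fst) = b at *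
      generalize (u n).toFun d.snd = a' at *
      generalize (u n).toFun d.fst = b' at *
      generalize h.1 d.snd = s at *
      generalize h.1 d.fst = t at *
      generalize f.1 d.snd = v at *
      generalize f.1 d.fst = w at *
      -- A discrete Leibniz rule: the first term is at most C times the difference of u n - h plus a
      -- fixed multiple of |s - t|, the second at most 2M|v - w|.
      have e1 : v * a - v * s - (w * b - w * t) = v * ((a - b) - (s - t)) + (b - t) * (v - w) := by
        ring
      have e2 : C * (a' - s) - C * (b' - t) = C * ((a' - b') - (s - t)) := by ring
      rw [e1, e2]
      have i1 : |a' - b'| ≤ |(a' - b') - (s - t)| + |s - t| := by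
        simpa using abs_add_le ((a' - b') - (s - t)) (s - t)
      have i2 : |(a - b) - (s - t)| ≤ |(a' - b') - (s - t)| + 2 * |s - t| := by
        linarith [abs_sub (a - b) (s - t)]
      have i3 : |b - t| ≤ 2 * M := by linarith [abs_sub b t]
      refine (abs_add_le _ _).trans ?_
      simp only [abs_mul, abs_two, abs_of_nonneg hC0, abs_of_nonneg hM0]
      have j1 := mul_le_mul h4 i2 (abs_nonneg _) hC0
      have j2 := mul_le_mul_of_nonneg_right i3 (abs_nonneg (v - w))
      linarith
    · intro x
      have h1 := tendsto_apply hG hlim x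
      have h2 := ((continuous_clamp M).tendsto _).comp h1
      have h3 : clamp M (h.1 x) = h.1 x := clamp_eq_self (hM x)
      have h4 := h2.const_mul (f.1 x)
      change Tendsto (fun n => f.1 x * clamp M ((u n).toFun x)) atTop (𝓝 (f.1 x * h.1 x))
      rw [← h3]
      exact h4

variable {hG : G.Preconnected}

/-- Such a k is divisible by h in the algebra: k = (k q h) h with q = 1 / max(h², δ²). The lower
cutoff δ² makes q bounded and a Lipschitz function of h², hence Dirichlet finite. -/
theorem mem_nullIdeal_of_eq_zero {h k : boundedDirichlet G p} (hh : h ∈ nullIdeal hG p o) {δ : ℝ}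
    (hδ : 0 < δ) (hk : ∀ x, |h.1 x| < δ → k.1 x = 0) : k ∈ nullIdeal hG p o := by
  have hpos : ∀ t : ℝ, 0 < max t (δ ^ 2) := fun t => lt_max_of_lt_right (by positivity)
  have hq : (fun x => (max ((h * h).1 x) (δ ^ 2))⁻¹) ∈ boundedDirichlet G p := by
    refine ⟨(h * h).2.1.of_abs_sub_le ((δ ^ 2)⁻¹ * (δ ^ 2)⁻¹) fun x y => ?_,
      (δ ^ 2)⁻¹, fun x => ?_⟩
    · rw [inv_sub_inv (hpos _).ne' (hpos _).ne', abs_div, abs_sub_comm, div_eq_inv_mul, abs_mul,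
        abs_of_pos (hpos _), abs_of_pos (hpos _), mul_inv]
      have hle : ∀ t : ℝ, (max t (δ ^ 2))⁻¹ ≤ (δ ^ 2)⁻¹ := fun t =>
        inv_anti₀ (by positivity) (le_max_right _ _)
      exact mul_le_mul (mul_le_mul (hle _) (hle _) (inv_nonneg.mpr (hpos _).le) (by positivity))
        (abs_max_sub_max_le_abs _ _ _) (abs_nonneg _) (by positivity)
    · rw [abs_of_pos (inv_pos.mpr (hpos _))]
      exact inv_anti₀ (by positivity) (le_max_right _ _)
  have hfac : k = (k * ⟨_, hq⟩ * h) * h := by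
    refine Subtype.ext (funext fun x => ?_)
    change k.1 x = k.1 x * (max (h.1 x * h.1 x) (δ ^ 2))⁻¹ * h.1 x * h.1 x
    by_cases hx : |h.1 x| < δ
    · simp [hk x hx]
    · have h1 : δ ^ 2 ≤ h.1 x * h.1 x := by
        rw [← abs_mul_abs_self, ← pow_two]
        exact pow_le_pow_left₀ hδ.le (not_lt.mp hx) 2
      have h2 : h.1 x ≠ 0 := by
        rintro h0
        rw [h0, abs_zero] at hx
        exact hx hδ
      rw [max_eq_left h1]
      field_simp
  rw [hfac]
  exact Ideal.mul_mem_left _ _ hh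

/-- The filter on `V` along which all bounded functions in the closure of the finitely supported
functions tend to zero. -/
noncomputable def nullFilter (hG : G.Preconnected) (p : ℝ) [Fact (1 < p)] (o : V) : Filter V where
  sets := {A | ∃ h ∈ nullIdeal hG p o, ∃ ε > 0, ∀ x, |h.1 x| < ε → x ∈ A}
  univ_sets := ⟨0, Ideal.zero_mem _, 1, one_pos, fun _ _ => trivial⟩
  sets_of_superset := by
    rintro A B ⟨h, hh, ε, hε, H⟩ hAB
    exact ⟨h, hh, ε, hε, fun x hx => hAB (H x hx)⟩
  inter_sets := by
    rintro A B ⟨h, hh, ε, hε, H⟩ ⟨k, hk, δ, hδ, K⟩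
    -- A sum of squares is small only where both h and k are small.
    refine ⟨h * h + k * k, Ideal.add_mem _ (Ideal.mul_mem_left _ _ hh) (Ideal.mul_mem_left _ _ hk),
      min (ε ^ 2) (δ ^ 2), lt_min (by positivity) (by positivity), fun x hx => ?_⟩
    change |h.1 x * h.1 x + k.1 x * k.1 x| < _ at hx
    have hx' := (le_abs_self _).trans_lt hx
    obtain ⟨h1, h2⟩ := lt_min_iff.mp hx'
    constructor
    · exact H x (abs_lt_of_sq_lt_sq (by nlinarith [mul_self_nonneg (k.1 x)]) hε.le)
    · exact K x (abs_lt_of_sq_lt_sq (by nlinarith [mul_self_nonneg (h.1 x)]) hδ.le)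

theorem mem_nullFilter {A : Set V} : A ∈ nullFilter hG p o ↔
    ∃ h ∈ nullIdeal hG p o, ∃ ε > 0, ∀ x, |h.1 x| < ε → x ∈ A := Iff.rfl

theorem tendsto_nullFilter {h : boundedDirichlet G p} (hh : h ∈ nullIdeal hG p o) :
    Tendsto h.1 (nullFilter hG p o) (𝓝 0) := by
  rw [Metric.tendsto_nhds]
  intro ε hε
  exact ⟨h, hh, ε, hε, fun x hx => by simpa [Real.dist_eq] using hx⟩

/-- If the empty set belonged to the filter, some h in the ideal would be bounded away from 0, and
the divisibility lemma would put 1 in the ideal. -/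
theorem nullFilter_neBot (h1 : (1 : boundedDirichlet G p) ∉ nullIdeal hG p o) :
    (nullFilter hG p o).NeBot := by
  refine ⟨fun hbot => h1 ?_⟩
  obtain ⟨h, hh, ε, hε, H⟩ := mem_nullFilter.mp (empty_mem_iff_bot.mpr hbot)
  exact mem_nullIdeal_of_eq_zero hh hε fun x hx => (H x hx).elim

/-- The difference of k and its truncation to [-ε, ε] vanishes wherever |k| < ε, hence wherever some
h in the ideal is small, so it lies in the ideal. As ε → 0 it converges to k in D_p(G), and the
closure is closed. -/
theorem mem_nullIdeal_of_tendsto {k : boundedDirichlet G p}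
    (hk : Tendsto k.1 (nullFilter hG p o) (𝓝 0)) : k ∈ nullIdeal hG p o := by
  have hlim := (tendsto_const_nhds (x := boundedDirichlet.toDirichletSpace G p o k)).sub
    (tendsto_clamp_zero (boundedDirichlet.toDirichletSpace G p o k))
  rw [sub_zero] at hlim
  refine isClosed_closureFinsupp.mem_of_tendsto hlim ?_
  filter_upwards [self_mem_nhdsWithin] with ε hε
  have hε' : 0 < ε := hε
  obtain ⟨h, hh, δ, hδ, H⟩ := mem_nullFilter.mp (Metric.tendsto_nhds.mp hk ε hε')
  have hc : (fun x => clamp ε (k.1 x)) ∈ boundedDirichlet G p :=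
    ⟨k.2.1.clamp ε, ε, fun x => abs_clamp_le hε'.le _⟩
  have key : k - ⟨_, hc⟩ ∈ nullIdeal hG p o := by
    refine mem_nullIdeal_of_eq_zero hh hδ fun x hx => ?_
    have h1 : |k.1 x| < ε := by simpa [Real.dist_eq] using H x hx
    change k.1 x - clamp ε (k.1 x) = 0
    rw [clamp_eq_self h1.le, sub_self]
  exact key

theorem exists_tendsto_ultrafilter (U : Ultrafilter V) (f : boundedDirichlet G p) :
    ∃ c : ℝ, Tendsto f.1 U (𝓝 c) := by
  obtain ⟨C, hC⟩ := f.2.2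
  obtain ⟨c, -, hc⟩ := isCompact_iff_ultrafilter_le_nhds'.mp (isCompact_Icc (a := -C) (b := C))
    (U.map f.1) (Eventually.of_forall (f := (U : Filter V)) fun x => abs_le.mp (hC x))
  exact ⟨c, hc⟩

/-- The limit along `U` of a bounded `p`-Dirichlet finite function. -/
noncomputable def ultrafilterLimit (U : Ultrafilter V) (f : boundedDirichlet G p) : ℝ :=
  (exists_tendsto_ultrafilter U f).choose

theorem tendsto_ultrafilterLimit (U : Ultrafilter V) (f : boundedDirichlet G p) :
    Tendsto f.1 U (𝓝 (ultrafilterLimit U f)) :=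
  (exists_tendsto_ultrafilter U f).choose_spec

theorem ultrafilterLimit_eq {U : Ultrafilter V} {f : boundedDirichlet G p} {c : ℝ}
    (h : Tendsto f.1 U (𝓝 c)) : ultrafilterLimit U f = c :=
  tendsto_nhds_unique (tendsto_ultrafilterLimit U f) h

variable (G p) in
/-- The character `f ↦ lim_U f` attached to an ultrafilter `U` on `V`. -/
noncomputable def ultrafilterCharacter (U : Ultrafilter V) : Character G p :=
  Complex.ofRealAm.comp
    { toFun := ultrafilterLimit U
      map_one' := ultrafilterLimit_eq tendsto_const_nhds
      map_zero' := ultrafilterLimit_eq tendsto_const_nhds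
      map_mul' := fun f h => ultrafilterLimit_eq
        ((tendsto_ultrafilterLimit U f).mul (tendsto_ultrafilterLimit U h))
      map_add' := fun f h => ultrafilterLimit_eq
        ((tendsto_ultrafilterLimit U f).add (tendsto_ultrafilterLimit U h))
      commutes' := fun _ => ultrafilterLimit_eq tendsto_const_nhds }

theorem ultrafilterCharacter_apply (U : Ultrafilter V) (f : boundedDirichlet G p) :
    ultrafilterCharacter G p U f = (ultrafilterLimit U f : ℂ) := rfl

/-- Point masses lie in the null ideal, so the character kills the indicator of each x, whereas i(x)
sends it to 1; this excludes the vertex characters. -/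
theorem ultrafilterCharacter_mem_harmonicBoundary
    (hfin : ∀ x : V, IsDirichletFinite G p (({x} : Set V).indicator 1)) {U : Ultrafilter V}
    (hU : (U : Filter V) ≤ nullFilter hG p o) :
    ultrafilterCharacter G p U ∈ harmonicBoundary G p o := by
  have hvan : ∀ f ∈ nullIdeal hG p o, ultrafilterCharacter G p U f = 0 := fun f hf => by
    rw [ultrafilterCharacter_apply, ultrafilterLimit_eq ((tendsto_nullFilter hf).mono_left hU),
      Complex.ofReal_zero]
  refine ⟨?_, hvan⟩
  rintro ⟨x, hx⟩
  have hb : ({x} : Set V).indicator (1 : V → ℝ) ∈ boundedDirichlet G p := by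
    refine ⟨hfin x, 1, fun y => ?_⟩
    by_cases hy : y = x <;> simp [hy]
  have h0 : (⟨_, hb⟩ : boundedDirichlet G p) ∈ nullIdeal hG p o :=
    mem_closureFinsupp_of_finite ((Set.finite_singleton x).subset Set.support_indicator_subset)
  have h1 := hvan _ h0
  rw [← hx] at h1
  change ((({x} : Set V).indicator (1 : V → ℝ) x : ℝ) : ℂ) = 0 at h1
  simp at h1

/-- A bounded function that is not a constant modulo the closure of the finitely supported
functions has two different limits at the `p`-harmonic boundary. -/
theorem one_lt_encard_harmonicBoundary (hG : G.Preconnected)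
    (hfin : ∀ x : V, IsDirichletFinite G p (({x} : Set V).indicator 1))
    (f : boundedDirichlet G p)
    (hf : ∀ c : ℝ, f - algebraMap ℝ _ c ∉ nullIdeal hG p o) :
    1 < (harmonicBoundary G p o).encard := by
  have h1 : (1 : boundedDirichlet G p) ∉ nullIdeal hG p o := fun h => hf 0 (by
    simpa using Ideal.mul_mem_left _ f h)
  have := nullFilter_neBot h1
  set U := Ultrafilter.of (nullFilter hG p o)
  have hU : (U : Filter V) ≤ nullFilter hG p o := Ultrafilter.of_le _
  set c := ultrafilterLimit U f
  -- Convergence to c would put f - c in the ideal. So some finer ultrafilter W misses the limit c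
  -- attained along U.
  have hc : ¬ Tendsto f.1 (nullFilter hG p o) (𝓝 c) := fun h =>
    hf c (mem_nullIdeal_of_tendsto (by
      have h0 := h.sub_const c
      rwa [sub_self] at h0))
  rw [tendsto_iff_ultrafilter] at hc
  push Not at hc
  obtain ⟨W, hW, hWc⟩ := hc
  refine Set.one_lt_encard_iff.mpr ⟨_, _, ultrafilterCharacter_mem_harmonicBoundary hfin hU,
    ultrafilterCharacter_mem_harmonicBoundary hfin hW, fun h => hWc ?_⟩
  have h2 := DFunLike.congr_fun h f
  rw [ultrafilterCharacter_apply, ultrafilterCharacter_apply, Complex.ofReal_inj] at h2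
  have h3 := tendsto_ultrafilterLimit W f
  rwa [← h2] at h3

end Boundary

/-- Hahn–Banach: a point outside a closed subspace of a seminormed space is separated from it by
a continuous functional. -/
theorem exists_strongDual_eq_zero_of_notMem {E : Type*} [SeminormedAddCommGroup E]
    [NormedSpace ℝ E] {K : Submodule ℝ E} (hK : IsClosed (K : Set E)) {x : E} (hx : x ∉ K) :
    ∃ L : E →L[ℝ] ℝ, (∀ y ∈ K, L y = 0) ∧ L x ≠ 0 := by
  obtain ⟨L, u, hL, hux⟩ := geometric_hahn_banach_closed_point K.convex hK hx
  have h0 : 0 < u := by simpa using hL 0 K.zero_mem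
  refine ⟨L, fun y hy => ?_, (h0.trans hux).ne'⟩
  by_contra hne
  -- The multiple of y on which L equals u is still in K, contradicting L < u there.
  have h1 := hL ((u / L y) • y) (K.smul_mem _ hy)
  rw [map_smul, smul_eq_mul, div_mul_cancel₀ _ hne] at h1
  exact lt_irrefl _ h1

/-! ### Point masses and invariant functionals on the Cayley graph -/

section Group

variable {Γ : Type*} [Group Γ] {S : Set Γ} {p : ℝ}

theorem preconnected_mulCayley (hgen : Subgroup.closure S = ⊤) :
    (SimpleGraph.mulCayley S).Preconnected := by
  have H : ∀ t x : Γ, (SimpleGraph.mulCayley S).Reachable x (x * t) := by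
    intro t
    have ht : t ∈ Subgroup.closure S := by rw [hgen]; trivial
    induction ht using Subgroup.closure_induction with
    | mem s hs =>
      intro x
      by_cases h : x = x * s
      · rw [← h]
      · exact SimpleGraph.Adj.reachable
          ((SimpleGraph.mulCayley_adj' S _ _).mpr ⟨h, s, hs, Or.inl rfl⟩)
    | one => intro x; rw [mul_one]
    | mul a b _ _ ha hb => intro x; rw [← mul_assoc]; exact (ha x).trans (hb _)
    | inv a _ ha => intro x; simpa using (ha (x * a⁻¹)).symm
  intro x y
  simpa using H (x⁻¹ * y) x

/-- The Cayley graph of a finite set has bounded degree, so `p`-th powers of an `ℓ^p` function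
are summable over its darts. -/
theorem summable_dart_fst (hS : S.Finite) {a : Γ → ℝ} (ha0 : ∀ x, 0 ≤ a x) (ha : Summable a) :
    Summable fun d : (SimpleGraph.mulCayley S).Dart => a d.fst := by
  have hmem : ∀ d : (SimpleGraph.mulCayley S).Dart, d.fst⁻¹ * d.snd ∈ S ∪ S⁻¹ := by
    intro d
    obtain ⟨-, g, hg, h | h⟩ := (SimpleGraph.mulCayley_adj' S _ _).mp d.adj
    · left; rw [← h]; simpa using hg
    · right; rw [h]; simpa using hg
  have : Finite (S ∪ S⁻¹ : Set Γ) := (hS.union hS.inv).to_subtype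
  have hsum : Summable fun q : (S ∪ S⁻¹ : Set Γ) × Γ => a q.2 := by
    rw [summable_prod_of_nonneg fun q => ha0 _]
    exact ⟨fun _ => ha, Summable.of_finite⟩
  -- A dart is determined by its first vertex and the quotient of its endpoints, which lies in the
  -- finite set S ∪ S⁻¹.
  refine hsum.comp_injective
    (i := fun d : (SimpleGraph.mulCayley S).Dart => (⟨_, hmem d⟩, d.fst)) fun d e h => ?_
  simp only [Prod.mk.injEq, Subtype.mk.injEq] at h
  obtain ⟨h1, h2⟩ := h
  rw [h2, mul_right_inj] at h1
  exact SimpleGraph.Dart.ext d e (Prod.ext h2 h1)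

theorem summable_dart_snd (hS : S.Finite) {a : Γ → ℝ} (ha0 : ∀ x, 0 ≤ a x) (ha : Summable a) :
    Summable fun d : (SimpleGraph.mulCayley S).Dart => a d.snd :=
  (summable_dart_fst hS ha0 ha).comp_injective (i := SimpleGraph.Dart.symm)
    SimpleGraph.Dart.symm_involutive.injective

variable [hp : Fact (1 < p)]

theorem summable_dart_add (hS : S.Finite) {h : Γ → ℝ} (hh : Summable fun x => |h x| ^ p) :
    Summable fun d : (SimpleGraph.mulCayley S).Dart => |(|h d.snd| + |h d.fst|)| ^ p := by
  have h0 : ∀ x, 0 ≤ |h x| ^ p := fun _ => Real.rpow_nonneg (abs_nonneg _) _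
  refine summable_abs_rpow_add hp.out.le ?_ ?_ <;> simp only [abs_abs]
  · exact summable_dart_snd hS h0 hh
  · exact summable_dart_fst hS h0 hh

theorem isDirichletFinite_of_summable (hS : S.Finite) {h : Γ → ℝ}
    (hh : Summable fun x => |h x| ^ p) : IsDirichletFinite (SimpleGraph.mulCayley S) p h :=
  summable_abs_rpow_mono (by linarith [hp.out]) (summable_dart_add hS hh) fun d =>
    (abs_sub _ _).trans (le_abs_self _)

theorem summable_abs_rpow_indicator_one {α : Type*} (s : Finset α) :
    Summable fun x => |(s : Set α).indicator (1 : α → ℝ) x| ^ p := by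
  refine summable_of_ne_finset_zero (s := s) fun x hx => ?_
  have : x ∉ (s : Set α) := by simpa using hx
  rw [Set.indicator_of_notMem this, abs_zero, Real.zero_rpow (by linarith [hp.out])]

theorem isDirichletFinite_indicator_singleton (hS : S.Finite) (x : Γ) :
    IsDirichletFinite (SimpleGraph.mulCayley S) p (({x} : Set Γ).indicator 1) :=
  isDirichletFinite_of_summable hS (by simpa using summable_abs_rpow_indicator_one (p := p) {x})

/-- The indicator function of `x`, as an element of `D_p(Γ)`. -/
noncomputable def pointMass (hS : S.Finite) (p : ℝ) [Fact (1 < p)] (x : Γ) :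
    GroupDirichletSpace S p :=
  .mk (({x} : Set Γ).indicator 1) (isDirichletFinite_indicator_singleton hS x)

theorem toFun_sum {ι : Type*} (s : Finset ι) (F : ι → GroupDirichletSpace S p) (x : Γ) :
    (∑ i ∈ s, F i).toFun x = ∑ i ∈ s, (F i).toFun x := by
  classical
  induction s using Finset.induction_on with
  | empty => rfl
  | insert a s ha ih => rw [Finset.sum_insert ha, Finset.sum_insert ha, ← ih]; rfl

theorem toFun_sum_smul_pointMass (hS : S.Finite) (s : Finset Γ) (h : Γ → ℝ) (x : Γ) :
    (∑ y ∈ s, h y • pointMass hS p y).toFun x = (s : Set Γ).indicator h x := by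
  classical
  rw [toFun_sum]
  have h1 : ∀ y, (h y • pointMass hS p y).toFun x = if x = y then h y else 0 := fun y => by
    change h y * ({y} : Set Γ).indicator (1 : Γ → ℝ) x = _
    by_cases hxy : x = y <;> simp [hxy]
  simp only [h1, Finset.sum_ite_eq, Set.indicator_apply, Finset.mem_coe]

/-- An `ℓ^p` function is the sum in `D_p(Γ)` of its values times the point masses. -/
theorem hasSum_smul_pointMass (hS : S.Finite) {h : Γ → ℝ} (hh : Summable fun x => |h x| ^ p) :
    HasSum (fun x => h x • pointMass hS p x)
      (.mk h (isDirichletFinite_of_summable hS hh) : GroupDirichletSpace S p) := by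
  refine DirichletSpace.tendsto_of_dominated (U := 0) (b := fun d => |h d.snd| + |h d.fst|)
    (fun d => add_nonneg (abs_nonneg _) (abs_nonneg _)) (summable_dart_add hS hh)
    tendsto_const_nhds ?_ ?_
  · refine Eventually.of_forall fun s d => le_add_of_nonneg_of_le (abs_nonneg _) ?_
    rw [toFun_sum_smul_pointMass, toFun_sum_smul_pointMass]
    have key : ∀ x, |(s : Set Γ).indicator h x - h x| ≤ |h x| := fun x => by
      by_cases hx : x ∈ (s : Set Γ)
      · simp [Set.indicator_of_mem hx]
      · simp [Set.indicator_of_notMem hx]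
    exact (abs_sub _ _).trans (add_le_add (key _) (key _))
  · intro x
    refine tendsto_const_nhds.congr' ?_
    filter_upwards [eventually_ge_atTop {x}] with s hs
    have hx : x ∈ (s : Set Γ) := by simpa using hs
    rw [toFun_sum_smul_pointMass, Set.indicator_of_mem hx]
    rfl

theorem translate_pointMass (hS : S.Finite) (hgen : Subgroup.closure S = ⊤) (x : Γ) :
    translate hS hgen x (pointMass hS p 1) = pointMass hS p x := by
  refine DirichletSpace.ext (funext fun g => ?_)
  change ({1} : Set Γ).indicator (1 : Γ → ℝ) (g * x⁻¹) = ({x} : Set Γ).indicator 1 g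
  by_cases h : g = x
  · simp [h]
  · have h1 : g * x⁻¹ ∉ ({1} : Set Γ) := fun hx => h (mul_inv_eq_one.mp hx)
    have h2 : g ∉ ({x} : Set Γ) := h
    rw [Set.indicator_of_notMem h1, Set.indicator_of_notMem h2]

/-- A continuous translation invariant functional vanishes on point masses. -/
theorem apply_pointMass_eq_zero [Infinite Γ] (hS : S.Finite) (hgen : Subgroup.closure S = ⊤)
    (L : GroupDirichletSpace S p →L[ℝ] ℝ) (hL : ∀ x f, L (translate hS hgen x f) = L f) (x : Γ) :
    L (pointMass hS p x) = 0 := by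
  have hconst : ∀ y, L (pointMass hS p y) = L (pointMass hS p 1) := fun y => by
    rw [← translate_pointMass hS hgen, hL]
  let e := Infinite.natEmbedding Γ
  -- The harmonic sequence on distinct points of Γ: in ℓ^p because p > 1, but not in ℓ^1. The term
  -- at n = 0 is 0.
  let h : Γ → ℝ := Function.extend e (fun n : ℕ => ((n : ℝ))⁻¹) 0
  have hh : Summable fun y => |h y| ^ p := by
    rw [← e.injective.summable_iff]
    · have : (fun y => |h y| ^ p) ∘ e = fun n : ℕ => ((n : ℝ) ^ p)⁻¹ := by
        funext n
        simp only [Function.comp, h, e.injective.extend_apply]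
        rw [abs_of_nonneg (by positivity), Real.inv_rpow (by positivity)]
      rw [this]
      exact Real.summable_nat_rpow_inv.mpr hp.out
    · intro y hy
      have : h y = 0 := Function.extend_apply' _ _ _ hy
      rw [this, abs_zero, Real.zero_rpow (by linarith [hp.out])]
  have hs := ((hasSum_smul_pointMass hS hh).mapL L).summable
  simp only [map_smul, hconst, smul_eq_mul] at hs
  rw [hconst]
  by_contra hne
  have hs2 := ((summable_mul_right_iff hne).mp hs).comp_injective e.injective
  refine Real.not_summable_natCast_inv (hs2.congr fun n => ?_)
  simp [h, e.injective.extend_apply]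

/-- A continuous functional vanishing on point masses vanishes on the closure of the finitely
supported functions. -/
theorem apply_eq_zero_of_mem_closureFinsupp (hS : S.Finite) {L : GroupDirichletSpace S p →L[ℝ] ℝ}
    (hL : ∀ x, L (pointMass hS p x) = 0) {f : GroupDirichletSpace S p}
    (hf : f ∈ DirichletSpace.closureFinsupp (SimpleGraph.mulCayley S) p 1) : L f = 0 := by
  refine closure_minimal (fun h hh => ?_) (isClosed_singleton.preimage L.continuous) hf
  have hfin : h.toFun.support.Finite := hh
  have heq : h = ∑ y ∈ hfin.toFinset, h.toFun y • pointMass hS p y := by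
    refine DirichletSpace.ext (funext fun x => ?_)
    rw [toFun_sum_smul_pointMass, Set.Finite.coe_toFinset, Set.indicator_support]
  change L h = 0
  rw [heq, map_sum]
  simp [hL]

/-- A continuous functional vanishing on point masses is translation invariant. -/
theorem apply_translate_of_apply_pointMass (hS : S.Finite) (hgen : Subgroup.closure S = ⊤)
    {L : GroupDirichletSpace S p →L[ℝ] ℝ} (hL : ∀ x, L (pointMass hS p x) = 0) (x : Γ)
    (f : GroupDirichletSpace S p) : L (translate hS hgen x f) = L f := by
  -- The function g ↦ f(g x⁻¹) - f(g) is in ℓ^p, so it is the D_p-sum of multiples of point masses.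
  have hs := (isDirichletFinite_cayley_iff hS hgen f.toFun).mp f.isDirichletFinite x⁻¹
  have h1 := (hasSum_smul_pointMass hS hs).mapL L
  simp only [map_smul, hL, smul_zero] at h1
  have h2 := h1.unique hasSum_zero
  have h3 : L (translate hS hgen x f - f) = 0 := h2
  rwa [map_sub, sub_eq_zero] at h3

end Group

end PHarmonic

/-! ### The equivalence -/

open PHarmonic

theorem theorem2p9 {Γ : Type*} [Group Γ] [Infinite Γ] (S : Set Γ) (hS : S.Finite)
    (hgen : Subgroup.closure S = ⊤) (p : ℝ) [Fact (1 < p)] :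
    1 < (PHarmonic.harmonicBoundary (SimpleGraph.mulCayley S) p (1 : Γ)).encard ↔
      ∃ T : PHarmonic.DirichletModConstants S p →L[ℝ] ℝ,
        T ≠ 0 ∧ PHarmonic.IsTranslationInvariant hS hgen T.toLinearMap := by
  let ι := boundedDirichlet.toDirichletSpace (SimpleGraph.mulCayley S) p (1 : Γ)
  have hconst : ∀ c : ℝ, ι (algebraMap ℝ _ c) = c • ι 1 := fun c =>
    DirichletSpace.ext (funext fun _ => (mul_one c).symm)
  have hsub : ∀ f (c : ℝ), ι (f - algebraMap ℝ _ c) = ι f - c • ι 1 := fun f c => by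
    rw [← hconst]; rfl
  constructor
  · intro h
    obtain ⟨τ, σ, hτ, hσ, hne⟩ := Set.one_lt_encard_iff.mp h
    have h1 : ι 1 ∉ DirichletSpace.closureFinsupp (SimpleGraph.mulCayley S) p 1 := fun h1 => by
      simpa using hτ.2 1 h1
    obtain ⟨L, hL0, hL1⟩ :=
      exists_strongDual_eq_zero_of_notMem DirichletSpace.isClosed_closureFinsupp h1
    obtain ⟨f, hf⟩ := DFunLike.ne_iff.mp hne
    -- This c is forced by the correction below: subtracting from M the multiple of L that makes N
    -- vanish at 1 gives N(f) = M(f - c), which is nonzero. Both L and M vanish on the closure,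
    -- hence so does N.
    let c : ℝ := L (ι f) / L (ι 1)
    have h2 : ι (f - algebraMap ℝ _ c) ∉
        DirichletSpace.closureFinsupp (SimpleGraph.mulCayley S) p 1 := fun h2 => by
      have e1 := hτ.2 _ h2
      have e2 := hσ.2 _ h2
      rw [map_sub, AlgHom.commutes, sub_eq_zero] at e1 e2
      exact hf (e1.trans e2.symm)
    obtain ⟨M, hM0, hM1⟩ :=
      exists_strongDual_eq_zero_of_notMem DirichletSpace.isClosed_closureFinsupp h2
    let N : GroupDirichletSpace S p →L[ℝ] ℝ := M - (M (ι 1) / L (ι 1)) • L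
    have hN0 : ∀ x, N (pointMass hS p x) = 0 := fun x => by
      have hx : pointMass hS p x ∈
          DirichletSpace.closureFinsupp (SimpleGraph.mulCayley S) p 1 :=
        DirichletSpace.mem_closureFinsupp_of_finite
          ((Set.finite_singleton x).subset Set.support_indicator_subset)
      simp [N, hL0 _ hx, hM0 _ hx]
    have hNf : N (ι f) ≠ 0 := by
      have : N (ι f) = M (ι (f - algebraMap ℝ _ c)) := by
        rw [hsub, map_sub, map_smul]
        change M (ι f) - (M (ι 1) / L (ι 1)) * L (ι f) = M (ι f) - c * M (ι 1)
        simp only [c]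
        ring
      rwa [this]
    have hker : constants S p ≤ N.ker := by
      rintro g ⟨a, ha⟩
      have hg : g = a • ι 1 := by
        rw [← hconst]
        exact DirichletSpace.ext (funext ha)
      change N g = 0
      have : N (ι 1) = 0 := by
        change M (ι 1) - (M (ι 1) / L (ι 1)) * L (ι 1) = 0
        field_simp
        ring
      rw [hg, map_smul, this, smul_zero]
    refine ⟨(constants S p).liftQL N hker, fun h0 => hNf ?_, fun x φ => ?_⟩
    · exact DFunLike.congr_fun h0 ((constants S p).mkQ (ι f))
    · obtain ⟨g, rfl⟩ := (constants S p).mkQ_surjective φ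
      exact apply_translate_of_apply_pointMass hS hgen hN0 x g
  · rintro ⟨T, hT, hinv⟩
    let L : GroupDirichletSpace S p →L[ℝ] ℝ := T.comp (constants S p).mkQL
    have hLc : L (ι 1) = 0 := by
      have : (constants S p).mkQ (ι 1) = 0 := by
        rw [Submodule.mkQ_apply, Submodule.Quotient.mk_eq_zero]
        exact ⟨1, fun _ => rfl⟩
      change T ((constants S p).mkQ (ι 1)) = 0
      rw [this, map_zero]
    have hL0 := apply_pointMass_eq_zero hS hgen L fun x f => hinv x ((constants S p).mkQ f)
    obtain ⟨f, hf⟩ : ∃ f, L (ι f) ≠ 0 := by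
      -- If L vanished on all bounded functions, it would vanish on every g, the limit of its
      -- truncations, and T would be 0.
      by_contra! H
      refine hT (ContinuousLinearMap.ext fun φ => ?_)
      obtain ⟨g, rfl⟩ := (constants S p).mkQ_surjective φ
      refine tendsto_nhds_unique ((L.continuous.tendsto g).comp g.tendsto_clamp)
        (tendsto_const_nhds.congr fun n => ?_)
      exact (H ⟨fun x => clamp n (g.toFun x), g.isDirichletFinite.clamp n, n,
        fun x => abs_clamp_le n.cast_nonneg _⟩).symm
    refine one_lt_encard_harmonicBoundary (preconnected_mulCayley hgen)
      (isDirichletFinite_indicator_singleton hS) f fun c hc => hf ?_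
    -- L kills both the closure and the constants, so f - c in the closure would give L f = 0.
    have h1 : L (ι (f - algebraMap ℝ _ c)) = 0 := apply_eq_zero_of_mem_closureFinsupp hS hL0 hc
    rwa [hsub, map_sub, map_smul, hLc, smul_zero, sub_zero] at h1
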